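/- Let $n\ge 0$ and let $C\in\mathbb{R}^{2^n\times 2^n}$ be symmetric, with Pauli expansion $C=\sum_{(x,z)\in\{0,1\}^{2n}}c_{(x,z)}P_{(x,z)}$, where $P_{(x,z)}=\bigotimes_{j=1}^n i^{x_jz_j}X^{x_j}Z^{z_j}$. For $A\subseteq[n]$ let $Z_A=P_{(0,1_A)}$ be the Pauli-$Z$ string supported on $A$. Let $\mathcal{G}_C$ be the group generated by the Pauli strings $P_{(x,z)}$ with $c_{(x,z)}\neq 0$, let $\mathcal{D}_C$ be the set of those $A\subseteq[n]$ with $Z_A\in\mathcal{G}_C$ or $-Z_A\in\mathcal{G}_C$ (the Pauli-$Z$ strings in $\mathcal{G}_C$, up to sign), and let $\dot{\mathcal{D}}_C=\mathcal{D}_C\setminus\{\varnothing\}$. For $S\subseteq 2^{[n]}\setminus\{\varnothing\}$ and $\epsilon\ge 0$ let $$\operatorname{GW}(C,S,\epsilon)=\max\Big\{\operatorname{tr}\big(\tfrac{C}{\|C\|}\rho\big)\;:\;\rho\in\mathbb{R}^{2^n\times 2^n},\ \rho\ge 0,\ \operatorname{tr}\rho=1,\ |\operatorname{tr}(Z_A\rho)|\le\epsilon\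 \ \forall A\in S\Big\},$$ $$\operatorname{GW}(C)=\max\Big\{\operatorname{tr}\big(\tfrac{C}{\|C\|}\rho\big)\;:\;\rho\in\mathbb{R}^{2^n\times 2^n},\ \rho\ge 0,\ \rho_{ii}=2^{-n}\ \ \forall i\Big\},$$ where $\|\cdot\|$ is the operator norm (and $C/\|C\|$ is read as $0$ if $C=0$). (1) For every $\epsilon\ge 0$, $\operatorname{GW}(C,\dot{\mathcal{D}}_C,\epsilon)=\operatorname{GW}(C,2^{[n]}\setminus\{\varnothing\},\epsilon)$. (2) There is a universal constant $K>0$, independent of $n$, $C$, $k$ and $\epsilon$, such that if $|\mathcal{D}_C|=2^k$ then, for every $\epsilon\ge 0$, $$\big|\operatorname{GW}(C,\dot{\mathcal{D}}_C,\epsilon)-\operatorname{GW}(C)\big|\le K\,(2^k-1)^{1/6}\,\epsilon^{1/3}.$$ Equivalently, for the objective $\operatorname{tr}(C\rho)$ in place of $\operatorname{tr}(\frac{C}{\|C\|}\rho)$ the two values differ by at most $K\,(2^k-1)^{1/6}\epsilon^{1/3}\|C\|$. -/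

import Mathlib

noncomputable section

/-- Computational basis states of `n` qubits; `2 ^ n × 2 ^ n` matrices are indexed by them. -/
abbrev Bits (n : ℕ) : Type := Fin n → Fin 2

/-! ### Pauli strings -/

/-- The Pauli matrix `X`. -/
def pauliX : Matrix (Fin 2) (Fin 2) ℂ := !![0, 1; 1, 0]

/-- The Pauli matrix `Z`. -/
def pauliZ : Matrix (Fin 2) (Fin 2) ℂ := !![1, 0; 0, -1]

/-- The single-qubit factor `i ^ (x z) X ^ x Z ^ z`. -/
def pauliOne (x z : Fin 2) : Matrix (Fin 2) (Fin 2) ℂ :=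
  Complex.I ^ ((x : ℕ) * (z : ℕ)) • (pauliX ^ (x : ℕ) * pauliZ ^ (z : ℕ))

/-- The Pauli string `P_(x,z)`, the tensor product over all qubits of `i ^ (x_j z_j) X ^ x_j Z ^ z_j`
(the entries of a tensor product of matrices are the products of the entries). -/
def pauliString {n : ℕ} (x z : Fin n → Fin 2) : Matrix (Bits n) (Bits n) ℂ :=
  Matrix.of fun a b => ∏ j, pauliOne (x j) (z j) (a j) (b j)

/-- The `0/1` indicator vector of a set of qubits. -/
def indicatorBits {n : ℕ} (A : Finset (Fin n)) : Fin n → Fin 2 := fun j => if j ∈ A then 1 else 0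

/-- The Pauli-`Z` string `Z_A`, as a real matrix: diagonal, with entry `(-1) ^ (∑_{j ∈ A} a_j)` at
the basis state `a`. -/
def zString {n : ℕ} (A : Finset (Fin n)) : Matrix (Bits n) (Bits n) ℝ :=
  Matrix.diagonal fun a => ∏ j ∈ A, (-1 : ℝ) ^ (a j : ℕ)

/-- `Z_A` is the Pauli string `P_(0, 1_A)`. -/
theorem pauliString_indicator {n : ℕ} (A : Finset (Fin n)) :
    pauliString 0 (indicatorBits A) = (zString A).map Complex.ofReal := by
  have key : ∀ (j : Fin n) (s t : Fin 2), pauliOne 0 (indicatorBits A j) s t =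
      if s = t then (if j ∈ A then (-1 : ℂ) ^ (s : ℕ) else 1) else 0 := by
    intro j s t
    by_cases h : j ∈ A <;> fin_cases s <;> fin_cases t <;>
      simp [pauliOne, indicatorBits, h, pauliX, pauliZ]
  ext a b
  simp only [pauliString, Matrix.of_apply, Pi.zero_apply, key, Matrix.map_apply, zString,
    Matrix.diagonal_apply]
  by_cases hab : a = b
  · subst hab
    simp [Finset.prod_ite_mem]
  · obtain ⟨j, hj⟩ := Function.ne_iff.mp hab
    rw [if_neg hab, Finset.prod_eq_zero (Finset.mem_univ j) (by rw [if_neg hj])]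
    simp

/-- Pauli strings square to the identity. -/
theorem pauliString_mul_self {n : ℕ} (x z : Fin n → Fin 2) :
    pauliString x z * pauliString x z = 1 := by
  have key : ∀ p q s t : Fin 2, ∑ c, pauliOne p q s c * pauliOne p q c t =
      if s = t then 1 else 0 := by
    intro p q s t
    fin_cases p <;> fin_cases q <;> fin_cases s <;> fin_cases t <;>
      simp [pauliOne, pauliX, pauliZ]
  ext a b
  simp only [Matrix.mul_apply, pauliString, Matrix.of_apply, ← Finset.prod_mul_distrib]
  rw [← Fintype.prod_sum fun j c => pauliOne (x j) (z j) (a j) c * pauliOne (x j) (z j) c (b j)]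
  simp only [key, Matrix.one_apply]
  by_cases hab : a = b
  · simp [hab]
  · obtain ⟨j, hj⟩ := Function.ne_iff.mp hab
    rw [if_neg hab, Finset.prod_eq_zero (Finset.mem_univ j) (by rw [if_neg hj])]

/-- A Pauli string as an invertible matrix (it is its own inverse). -/
def pauliUnit {n : ℕ} (x z : Fin n → Fin 2) : (Matrix (Bits n) (Bits n) ℂ)ˣ where
  val := pauliString x z
  inv := pauliString x z
  val_inv := pauliString_mul_self x z
  inv_val := pauliString_mul_self x z

/-- The coefficient of `P_(x,z)` in the Pauli expansion of `C`. -/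
def pauliCoeff {n : ℕ} (C : Matrix (Bits n) (Bits n) ℝ) (x z : Fin n → Fin 2) : ℂ :=
  ((2 : ℂ) ^ n)⁻¹ * (pauliString x z * C.map Complex.ofReal).trace

/-- The coefficients above are those of the Pauli expansion. -/
theorem pauli_expansion {n : ℕ} (C : Matrix (Bits n) (Bits n) ℝ) :
    C.map Complex.ofReal = ∑ x, ∑ z, pauliCoeff C x z • pauliString x z := by
  have key : ∀ s t u v : Fin 2, ∑ p, ∑ q, pauliOne p q u v * pauliOne p q s t =
      if v = s ∧ u = t then 2 else 0 := by
    intro s t u v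
    fin_cases s <;> fin_cases t <;> fin_cases u <;> fin_cases v <;>
      simp [pauliOne, pauliX, pauliZ, one_add_one_eq_two]
  have tot : ∀ a b c d : Bits n, ∑ x, ∑ z, pauliString x z c d * pauliString x z a b =
      if d = a ∧ c = b then (2 : ℂ) ^ n else 0 := by
    intro a b c d
    simp only [pauliString, Matrix.of_apply, ← Finset.prod_mul_distrib]
    have h1 : ∀ x : Fin n → Fin 2, ∑ z : Fin n → Fin 2,
        ∏ j, pauliOne (x j) (z j) (c j) (d j) * pauliOne (x j) (z j) (a j) (b j) =
        ∏ j, ∑ q, pauliOne (x j) q (c j) (d j) * pauliOne (x j) q (a j) (b j) := fun x =>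
      (Fintype.prod_sum fun j q =>
        pauliOne (x j) q (c j) (d j) * pauliOne (x j) q (a j) (b j)).symm
    simp only [h1]
    rw [← Fintype.prod_sum fun j p =>
      ∑ q, pauliOne p q (c j) (d j) * pauliOne p q (a j) (b j)]
    simp only [key]
    by_cases h : d = a ∧ c = b
    · simp [h.1, h.2]
    · rw [if_neg h]
      have : ∃ j, ¬(d j = a j ∧ c j = b j) := by
        by_contra hh
        push Not at hh
        exact h ⟨funext fun j => (hh j).1, funext fun j => (hh j).2⟩
      obtain ⟨j, hj⟩ := this
      exact Finset.prod_eq_zero (Finset.mem_univ j) (by rw [if_neg hj])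
  ext a b
  have step : (∑ x, ∑ z, pauliCoeff C x z • pauliString x z) a b =
      ((2 : ℂ) ^ n)⁻¹ * ∑ c, ∑ d, (C d c : ℂ) *
        ∑ x, ∑ z, pauliString x z c d * pauliString x z a b := by
    simp only [Matrix.sum_apply, Matrix.smul_apply, smul_eq_mul, pauliCoeff, Matrix.trace,
      Matrix.diag, Matrix.mul_apply, Matrix.map_apply, Finset.mul_sum, Finset.sum_mul]
    have e1 : ∀ f : Bits n → Bits n → Bits n → Bits n → ℂ,
        ∑ x, ∑ z, ∑ c, ∑ d, f x z c d = ∑ c, ∑ d, ∑ x, ∑ z, f x z c d := by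
      intro f
      calc _ = ∑ x, ∑ c, ∑ z, ∑ d, f x z c d := by
            refine Finset.sum_congr rfl fun x _ => Finset.sum_comm
        _ = ∑ c, ∑ x, ∑ d, ∑ z, f x z c d := by
            rw [Finset.sum_comm]
            refine Finset.sum_congr rfl fun c _ => Finset.sum_congr rfl fun x _ => Finset.sum_comm
        _ = _ := by
            refine Finset.sum_congr rfl fun c _ => Finset.sum_comm
    rw [e1]
    refine Finset.sum_congr rfl fun c _ => Finset.sum_congr rfl fun d _ =>
      Finset.sum_congr rfl fun x _ => Finset.sum_congr rfl fun z _ => ?_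
    ring
  rw [step]
  simp only [tot, ite_and, mul_ite, mul_zero, Finset.sum_ite_eq', Finset.mem_univ, if_true,
    Matrix.map_apply]
  field_simp

/-! ### The diagonal group -/

/-- The group `G_C` generated by the Pauli strings in the Pauli support of `C`. -/
def pauliGroupOf {n : ℕ} (C : Matrix (Bits n) (Bits n) ℝ) :
    Subgroup (Matrix (Bits n) (Bits n) ℂ)ˣ :=
  Subgroup.closure {g | ∃ x z, pauliCoeff C x z ≠ 0 ∧ g = pauliUnit x z}

/-- The diagonal group `D_C = G_C ∩ {± Z_A}`, recorded up to sign: the set of those `A` for which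
`Z_A` or `-Z_A` lies in `G_C`. -/
def diagGroup {n : ℕ} (C : Matrix (Bits n) (Bits n) ℝ) : Set (Finset (Fin n)) :=
  {A | pauliUnit 0 (indicatorBits A) ∈ pauliGroupOf C ∨
    -pauliUnit 0 (indicatorBits A) ∈ pauliGroupOf C}

/-- The elements of the diagonal group other than the identity `Z_∅`. -/
def diagGroupDot {n : ℕ} (C : Matrix (Bits n) (Bits n) ℝ) : Set (Finset (Fin n)) :=
  diagGroup C \ {∅}

/-! ### The semidefinite programs -/

/-- The operator norm of a real matrix with respect to the Euclidean norm. -/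
def opNorm {n : ℕ} (C : Matrix (Bits n) (Bits n) ℝ) : ℝ :=
  ‖Matrix.toEuclideanCLM (n := Bits n) (𝕜 := ℝ) C‖

/-- The feasible set of the relaxed program with constraint set `S` and tolerance `ε`. -/
def gwFeasible {n : ℕ} (S : Set (Finset (Fin n))) (ε : ℝ) : Set (Matrix (Bits n) (Bits n) ℝ) :=
  {ρ | ρ.PosSemidef ∧ ρ.trace = 1 ∧ ∀ A ∈ S, |(zString A * ρ).trace| ≤ ε}

/-- The feasible set of the exact program: every diagonal entry of `ρ` is `1 / 2 ^ n`. -/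
def gwExactFeasible (n : ℕ) : Set (Matrix (Bits n) (Bits n) ℝ) :=
  {ρ | ρ.PosSemidef ∧ ∀ a, ρ a a = 1 / 2 ^ n}

/-- `GW(C, S, ε)`: the value of the relaxed Goemans-Williamson program, with objective
`tr (C / ‖C‖) ρ`. -/
def GWrel {n : ℕ} (C : Matrix (Bits n) (Bits n) ℝ) (S : Set (Finset (Fin n))) (ε : ℝ) : ℝ :=
  sSup ((fun ρ => (((opNorm C)⁻¹ • C) * ρ).trace) '' gwFeasible S ε)

/-- `GW(C)`: the value of the normalized Goemans-Williamson program. -/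
def GW {n : ℕ} (C : Matrix (Bits n) (Bits n) ℝ) : ℝ :=
  sSup ((fun ρ => (((opNorm C)⁻¹ • C) * ρ).trace) '' gwExactFeasible n)

/-- The maximally mixed state is feasible for the exact program. -/
theorem maximallyMixed_mem_exact (n : ℕ) :
    ((1 / 2 ^ n : ℝ) • (1 : Matrix (Bits n) (Bits n) ℝ)) ∈ gwExactFeasible n := by
  refine ⟨Matrix.PosSemidef.one.smul (by positivity), fun a => ?_⟩
  simp

/-- The maximally mixed state is feasible for every relaxed program not constraining `Z_∅ = I`. -/
theorem maximallyMixed_mem {n : ℕ} {S : Set (Finset (Fin n))} (hS : ∅ ∉ S) {ε : ℝ} (hε : 0 ≤ ε) :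
    ((1 / 2 ^ n : ℝ) • (1 : Matrix (Bits n) (Bits n) ℝ)) ∈ gwFeasible S ε := by
  refine ⟨Matrix.PosSemidef.one.smul (by positivity), by simp, fun A hA => ?_⟩
  have hz : (zString A).trace = 0 := by
    obtain ⟨j, hj⟩ : A.Nonempty := Finset.nonempty_iff_ne_empty.mpr fun h => hS (h ▸ hA)
    have h1 : (zString A).trace = ∑ a : Bits n, ∏ j, if j ∈ A then (-1 : ℝ) ^ (a j : ℕ) else 1 := by
      simp [zString, Matrix.trace_diagonal, Finset.prod_ite_mem]
    rw [h1, ← Fintype.prod_sum fun (j : Fin n) (c : Fin 2) =>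
      if j ∈ A then (-1 : ℝ) ^ (c : ℕ) else 1]
    exact Finset.prod_eq_zero (Finset.mem_univ j) (by simp [hj])
  simpa [hz] using hε

/-- The objective is bounded on density matrices, so the suprema above are genuine. -/
theorem bddAbove_objective {n : ℕ} (M : Matrix (Bits n) (Bits n) ℝ)
    (F : Set (Matrix (Bits n) (Bits n) ℝ)) (hF : ∀ ρ ∈ F, ρ.PosSemidef ∧ ρ.trace = 1) :
    BddAbove ((fun ρ => (M * ρ).trace) '' F) := by
  refine ⟨∑ a, ∑ b, |M a b|, ?_⟩
  rintro _ ⟨ρ, hρ, rfl⟩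
  obtain ⟨hp, ht⟩ := hF ρ hρ
  have hd : ∀ a, ρ a a ≤ 1 := fun a => by
    rw [← ht]
    exact Finset.single_le_sum (f := fun a => ρ a a) (fun b _ => hp.diag_nonneg)
      (Finset.mem_univ a)
  have hs : ∀ a b, |ρ a b| ≤ 1 := fun a b => by
    have h2 := (hp.submatrix ![a, b]).det_nonneg
    have hsym : ρ b a = ρ a b := by simpa using hp.1.apply a b
    simp only [Matrix.det_fin_two, Matrix.submatrix_apply, Matrix.cons_val_zero,
      Matrix.cons_val_one, hsym] at h2
    have ha : 0 ≤ ρ a a := hp.diag_nonneg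
    have hb : 0 ≤ ρ b b := hp.diag_nonneg
    rw [abs_le_one_iff_mul_self_le_one]
    nlinarith [mul_le_one₀ (hd a) hb (hd b)]
  simp only [Matrix.trace, Matrix.diag, Matrix.mul_apply]
  refine Finset.sum_le_sum fun a _ => Finset.sum_le_sum fun b _ => ?_
  calc M a b * ρ b a ≤ |M a b * ρ b a| := le_abs_self _
    _ = |M a b| * |ρ b a| := abs_mul _ _
    _ ≤ |M a b| := mul_le_of_le_one_right (abs_nonneg _) (hs b a)

end

/-!
Conjugation by a Pauli string multiplies every Pauli string by a sign, given by the symplectic form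
on the labels in `𝔽₂ⁿ × 𝔽₂ⁿ`. If neither `Z_A` nor `-Z_A` lies in the group generated by the Pauli
support of `C`, then the label of `Z_A` is outside the span of the labels of the support: `C` being
symmetric, the support consists of real Pauli strings, so products never pick up a factor `± i`. By
duality over `𝔽₂` some Pauli string commutes with `C` and anticommutes with `Z_A`
(`exists_pauliConj_of_notMem_diagGroup`). Averaging a density matrix with its conjugate then keeps the
objective, increases no Pauli-`Z` expectation and makes that of `Z_A` vanish; doing so for all such `A`
(`exists_symmetrized`) shows that the constraints outside the diagonal group are redundant.

For the comparison with the exact program, symmetrize a feasible `ρ`. By Parseval's identity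
(`sum_sq_diag_sub`) its diagonal `d` satisfies `2ⁿ ∑ (d_a - 2⁻ⁿ)² ≤ δ²` with
`δ = √(2 ^ k - 1) ε`. Write `ρ = Bᵀ B`, shrink the columns of `B` of squared length above `2⁻ⁿ` to that
length, and fill up the diagonal by a nonnegative diagonal matrix. The result is feasible for the exact
program, and by the Cauchy-Schwarz inequality no objective of operator norm at most one decreases by
more than `3 δ` (`exists_mem_gwExactFeasible_close`). Since both values lie in `[-1, 1]`, the gap is
also at most `2`, hence at most `3 δ ^ (1 / 3)` in all cases.
-/

noncomputable section

/-! ### Sign characters of the basis states -/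

/-- The character `s ↦ (-1) ^ (b · s)` of the group `𝔽₂ⁿ` of basis states. -/
def bitSign {n : ℕ} (b s : Fin n → Fin 2) : ℝ := ∏ j, (-1 : ℝ) ^ ((b j : ℕ) * (s j : ℕ))

theorem bitSign_add_right {n : ℕ} (b s t : Fin n → Fin 2) :
    bitSign b (s + t) = bitSign b s * bitSign b t := by
  have key : ∀ p q r : Fin 2, (-1 : ℝ) ^ ((p : ℕ) * ((q + r : Fin 2) : ℕ)) =
      (-1) ^ ((p : ℕ) * (q : ℕ)) * (-1) ^ ((p : ℕ) * (r : ℕ)) := by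
    intro p q r
    fin_cases p <;> fin_cases q <;> fin_cases r <;> simp
  simp only [bitSign, Pi.add_apply, key, Finset.prod_mul_distrib]

theorem bitSign_comm {n : ℕ} (b s : Fin n → Fin 2) : bitSign b s = bitSign s b := by
  simp only [bitSign, mul_comm]

theorem bitSign_add_left {n : ℕ} (b c s : Fin n → Fin 2) :
    bitSign (b + c) s = bitSign b s * bitSign c s := by
  rw [bitSign_comm, bitSign_add_right, bitSign_comm s b, bitSign_comm s c]

theorem bitSign_eq_one_or {n : ℕ} (b s : Fin n → Fin 2) :
    bitSign b s = 1 ∨ bitSign b s = -1 := by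
  rw [bitSign, Finset.prod_pow_eq_pow_sum]
  exact neg_one_pow_eq_or ℝ _

theorem bitSign_mul_self {n : ℕ} (b s : Fin n → Fin 2) : bitSign b s * bitSign b s = 1 := by
  rcases bitSign_eq_one_or b s with h | h <;> simp [h]

theorem zString_eq_bitSign {n : ℕ} (A : Finset (Fin n)) :
    zString A = Matrix.diagonal (bitSign (indicatorBits A)) := by
  have key : ∀ (a : Bits n) (j : Fin n), (-1 : ℝ) ^ ((indicatorBits A j : ℕ) * (a j : ℕ)) =
      if j ∈ A then (-1 : ℝ) ^ (a j : ℕ) else 1 := by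
    intro a j
    by_cases h : j ∈ A <;> simp [indicatorBits, h]
  rw [zString]
  congr 1
  ext a
  simp [bitSign, key, Finset.prod_ite_mem]

theorem bits_add_self {n : ℕ} (a : Fin n → Fin 2) : a + a = 0 := by
  ext j
  have : ∀ c : Fin 2, c + c = 0 := by decide
  simp [this]

/-! ### Conjugation by Pauli strings -/

/-- Conjugation of `M` by the Pauli string with `X`-part `a` and `Z`-part `b`, entry by entry; the
phase of the Pauli string cancels, so that the result is again real. -/
def pauliConj {n : ℕ} (a b : Fin n → Fin 2) (M : Matrix (Bits n) (Bits n) ℝ) :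
    Matrix (Bits n) (Bits n) ℝ :=
  Matrix.of fun s t => bitSign b s * bitSign b t * M (s + a) (t + a)

theorem pauliConj_posSemidef {n : ℕ} (a b : Fin n → Fin 2) {M : Matrix (Bits n) (Bits n) ℝ}
    (hM : M.PosSemidef) : (pauliConj a b M).PosSemidef := by
  have h := (hM.submatrix (· + a)).conjTranspose_mul_mul_same (Matrix.diagonal (bitSign b))
  convert h using 1
  ext s t
  simp [pauliConj, Matrix.mul_diagonal, Matrix.diagonal_mul]
  ring

theorem trace_pauliConj {n : ℕ} (a b : Fin n → Fin 2) (M : Matrix (Bits n) (Bits n) ℝ) :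
    (pauliConj a b M).trace = M.trace := by
  simp only [Matrix.trace, Matrix.diag, pauliConj, Matrix.of_apply, bitSign_mul_self, one_mul]
  exact Equiv.sum_comp (Equiv.addRight a) fun s => M s s

theorem trace_mul_pauliConj {n : ℕ} (a b : Fin n → Fin 2) (M N : Matrix (Bits n) (Bits n) ℝ) :
    (M * pauliConj a b N).trace = (pauliConj a b M * N).trace := by
  rw [← trace_pauliConj a b (M * pauliConj a b N)]
  simp only [Matrix.trace, Matrix.diag, Matrix.mul_apply, pauliConj, Matrix.of_apply]
  refine Finset.sum_congr rfl fun s _ => ?_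
  rw [Finset.mul_sum, ← Equiv.sum_comp (Equiv.addRight a)]
  refine Finset.sum_congr rfl fun t _ => ?_
  simp only [Equiv.coe_addRight, add_assoc, bits_add_self, add_zero, bitSign_add_right]
  linear_combination (M (s + a) (t + a) * N t s * bitSign b s * bitSign b t) *
    (bitSign b s * bitSign b s * (bitSign_mul_self b a) + bitSign_mul_self b s)

theorem pauliConj_zString {n : ℕ} (a b : Fin n → Fin 2) (A : Finset (Fin n)) :
    pauliConj a b (zString A) = bitSign (indicatorBits A) a • zString A := by
  ext s t
  rw [zString_eq_bitSign]
  simp only [pauliConj, Matrix.of_apply, Matrix.smul_apply, Matrix.diagonal_apply, smul_eq_mul,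
    add_left_inj]
  split_ifs with h
  · subst h
    rw [bitSign_mul_self, bitSign_add_right]
    ring
  · simp

/-- Averaging with a conjugation that fixes `C` and flips the sign of `Z_A` makes the expectation of
`Z_A` vanish; it keeps the objective and does not increase the other Pauli-`Z` expectations. -/
theorem exists_killing_trace_zString {n : ℕ} {C ρ : Matrix (Bits n) (Bits n) ℝ}
    (hρ : ρ.PosSemidef) (F : Finset (Finset (Fin n)))
    (hF : ∀ A ∈ F, ∃ a b, pauliConj a b C = C ∧ bitSign (indicatorBits A) a = -1) :
    ∃ σ : Matrix (Bits n) (Bits n) ℝ, σ.PosSemidef ∧ σ.trace = ρ.trace ∧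
      (C * σ).trace = (C * ρ).trace ∧
      (∀ A, |(zString A * σ).trace| ≤ |(zString A * ρ).trace|) ∧
      ∀ A ∈ F, (zString A * σ).trace = 0 := by
  induction F using Finset.induction_on with
  | empty => exact ⟨ρ, hρ, rfl, rfl, fun _ => le_rfl, by simp⟩
  | insert A F _ ih =>
    obtain ⟨σ, hσ, htr, hobj, hle, hzero⟩ := ih fun B hB => hF B (Finset.mem_insert_of_mem hB)
    obtain ⟨a, b, hC, hA⟩ := hF A (Finset.mem_insert_self A F)
    have hz : ∀ B, (zString B * ((1 / 2 : ℝ) • (σ + pauliConj a b σ))).trace =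
        (1 + bitSign (indicatorBits B) a) / 2 * (zString B * σ).trace := by
      intro B
      rw [Matrix.mul_smul, Matrix.mul_add, Matrix.trace_smul, Matrix.trace_add,
        trace_mul_pauliConj, pauliConj_zString, Matrix.smul_mul, Matrix.trace_smul]
      simp only [smul_eq_mul]
      ring
    refine ⟨(1 / 2 : ℝ) • (σ + pauliConj a b σ),
      (hσ.add (pauliConj_posSemidef a b hσ)).smul (by norm_num), ?_, ?_, ?_, ?_⟩
    · rw [Matrix.trace_smul, Matrix.trace_add, trace_pauliConj, htr, smul_eq_mul]
      ring
    · rw [Matrix.mul_smul, Matrix.mul_add, Matrix.trace_smul, Matrix.trace_add,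
        trace_mul_pauliConj, hC, hobj, smul_eq_mul]
      ring
    · intro B
      rw [hz B]
      rcases bitSign_eq_one_or (indicatorBits B) a with h | h
      · norm_num [h, hle B]
      · norm_num [h]
    · intro B hB
      rw [hz B]
      rcases Finset.mem_insert.mp hB with rfl | hB
      · simp [hA]
      · simp [hzero B hB]

/-! ### Pauli strings with real entries -/

theorem pauliOne_apply (x z s t : Fin 2) : pauliOne x z s t =
    Complex.I ^ ((x : ℕ) * (z : ℕ)) *
      if s = t + x then (((-1 : ℝ) ^ ((z : ℕ) * (t : ℕ)) : ℝ) : ℂ) else 0 := by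
  fin_cases x <;> fin_cases z <;> fin_cases s <;> fin_cases t <;>
    simp [pauliOne, pauliX, pauliZ]

/-- The matrix `X ^ x Z ^ z = ⨂ⱼ X ^ xⱼ Z ^ zⱼ`, a Pauli string stripped of its phase. -/
def xzString {n : ℕ} (x z : Fin n → Fin 2) : Matrix (Bits n) (Bits n) ℂ :=
  Matrix.of fun s t => if s = t + x then (bitSign z t : ℂ) else 0

theorem pauliString_eq_smul_xzString {n : ℕ} (x z : Fin n → Fin 2) :
    pauliString x z = Complex.I ^ (∑ j, (x j : ℕ) * (z j : ℕ)) • xzString x z := by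
  ext s t
  simp only [pauliString, Matrix.of_apply, pauliOne_apply, Finset.prod_mul_distrib,
    Finset.prod_pow_eq_pow_sum, Matrix.smul_apply, xzString, smul_eq_mul]
  congr 1
  split_ifs with h
  · subst h
    simp [bitSign]
  · obtain ⟨j, hj⟩ := Function.ne_iff.mp h
    exact Finset.prod_eq_zero (Finset.mem_univ j) (if_neg hj)

theorem xzString_zero_zero {n : ℕ} : xzString (0 : Fin n → Fin 2) 0 = 1 := by
  ext s t
  simp [xzString, Matrix.one_apply, bitSign]

theorem xzString_mul {n : ℕ} (x z x' z' : Fin n → Fin 2) :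
    xzString x z * xzString x' z' = (bitSign z x' : ℂ) • xzString (x + x') (z + z') := by
  ext s t
  simp only [xzString, Matrix.mul_apply, Matrix.of_apply, Matrix.smul_apply, smul_eq_mul]
  rw [Finset.sum_eq_single (t + x') (fun u _ hu => by simp [hu]) (by simp)]
  simp only [if_true, bitSign_add_right, bitSign_add_left, add_assoc, add_comm x' x]
  split_ifs <;> push_cast <;> ring

theorem pauliString_zero_left {n : ℕ} (z : Fin n → Fin 2) :
    pauliString 0 z = xzString 0 z := by
  simp [pauliString_eq_smul_xzString]

theorem pauliString_transpose {n : ℕ} (x z : Fin n → Fin 2) :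
    (pauliString x z).transpose = (bitSign x z : ℂ) • pauliString x z := by
  have key : ∀ p q s t : Fin 2,
      pauliOne p q t s = (((-1 : ℝ) ^ ((p : ℕ) * (q : ℕ)) : ℝ) : ℂ) * pauliOne p q s t := by
    intro p q s t
    fin_cases p <;> fin_cases q <;> fin_cases s <;> fin_cases t <;>
      simp [pauliOne, pauliX, pauliZ]
  ext s t
  rw [Matrix.transpose_apply, Matrix.smul_apply, bitSign, smul_eq_mul, Complex.ofReal_prod]
  simp only [pauliString, Matrix.of_apply]
  rw [← Finset.prod_mul_distrib]
  exact Finset.prod_congr rfl fun j _ => key _ _ _ _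

/-- Only Pauli strings with an even number of factors `Y` occur in a real symmetric matrix, since the
others are antisymmetric. -/
theorem bitSign_eq_one_of_pauliCoeff_ne_zero {n : ℕ} {C : Matrix (Bits n) (Bits n) ℝ}
    (hC : C.IsSymm) {x z : Fin n → Fin 2} (h : pauliCoeff C x z ≠ 0) : bitSign x z = 1 := by
  refine (bitSign_eq_one_or x z).resolve_right fun hneg => h ?_
  have h1 : (pauliString x z * C.map Complex.ofReal).trace =
      -(pauliString x z * C.map Complex.ofReal).trace := by
    conv_lhs => rw [← Matrix.trace_transpose, Matrix.transpose_mul, pauliString_transpose,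
      ← Matrix.transpose_map, hC.eq, hneg, Matrix.mul_smul, Matrix.trace_smul, Matrix.trace_mul_comm]
    simp
  rw [pauliCoeff, self_eq_neg.mp h1, mul_zero]

/-- The Pauli strings in the support of a real symmetric matrix are real. -/
theorem exists_sign_pauliString_eq {n : ℕ} {C : Matrix (Bits n) (Bits n) ℝ}
    (hC : C.IsSymm) {x z : Fin n → Fin 2} (h : pauliCoeff C x z ≠ 0) :
    ∃ c : ℂ, (c = 1 ∨ c = -1) ∧ pauliString x z = c • xzString x z := by
  refine ⟨_, ?_, pauliString_eq_smul_xzString x z⟩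
  have h1 := bitSign_eq_one_of_pauliCoeff_ne_zero hC h
  rw [bitSign, Finset.prod_pow_eq_pow_sum, neg_one_pow_eq_one_iff_even (by norm_num)] at h1
  obtain ⟨m, hm⟩ := h1
  rw [hm, ← two_mul, pow_mul, Complex.I_sq]
  exact neg_one_pow_eq_or ℂ m

/-! ### The diagonal group and the symplectic complement of the Pauli support -/

/-- The binary span of the labels `(x, z)` of the Pauli strings in the support of `C`. -/
def supportSpan {n : ℕ} (C : Matrix (Bits n) (Bits n) ℝ) :
    Submodule (ZMod 2) ((Fin n → ZMod 2) × (Fin n → ZMod 2)) :=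
  Submodule.span (ZMod 2) {v | pauliCoeff C v.1 v.2 ≠ 0}

/-- Every label in the binary span is realised in the generated group by a real Pauli string, up to
sign. -/
theorem exists_mem_pauliGroupOf {n : ℕ} {C : Matrix (Bits n) (Bits n) ℝ} (hC : C.IsSymm)
    {v : (Fin n → ZMod 2) × (Fin n → ZMod 2)} (hv : v ∈ supportSpan C) :
    ∃ g ∈ pauliGroupOf C, ∃ c : ℂ, (c = 1 ∨ c = -1) ∧
      (g : Matrix (Bits n) (Bits n) ℂ) = c • xzString v.1 v.2 := by
  have hzero : ∃ g ∈ pauliGroupOf C, ∃ c : ℂ, (c = 1 ∨ c = -1) ∧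
      (g : Matrix (Bits n) (Bits n) ℂ) = c • xzString (0 : Fin n → Fin 2) 0 :=
    ⟨1, one_mem _, 1, Or.inl rfl, by rw [xzString_zero_zero, one_smul, Units.val_one]⟩
  induction hv using Submodule.span_induction with
  | mem v hv =>
    obtain ⟨c, hc, hP⟩ := exists_sign_pauliString_eq hC hv
    exact ⟨pauliUnit v.1 v.2, Subgroup.subset_closure ⟨_, _, hv, rfl⟩, c, hc, hP⟩
  | zero => exact hzero
  | add v w _ _ hv hw =>
    obtain ⟨g, hg, c, hc, hgc⟩ := hv
    obtain ⟨g', hg', c', hc', hgc'⟩ := hw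
    refine ⟨g * g', mul_mem hg hg', c * c' * (bitSign v.2 w.1 : ℂ), ?_, ?_⟩
    · rcases hc with rfl | rfl <;> rcases hc' with rfl | rfl <;>
        rcases bitSign_eq_one_or v.2 w.1 with h | h <;> simp [h]
    · rw [Units.val_mul, hgc, hgc', Matrix.smul_mul, Matrix.mul_smul]
      refine (congrArg (fun M => c • c' • M) (xzString_mul v.1 v.2 w.1 w.2)).trans ?_
      simp only [smul_smul, mul_assoc]
      rfl
  | smul r v _ hv =>
    have hr : r = 0 ∨ r = 1 := by revert r; decide
    rcases hr with rfl | rfl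
    · rw [zero_smul]; exact hzero
    · rw [one_smul]; exact hv

theorem mem_diagGroup_of_mem_supportSpan {n : ℕ} {C : Matrix (Bits n) (Bits n) ℝ}
    (hC : C.IsSymm) {A : Finset (Fin n)} (hA : (0, indicatorBits A) ∈ supportSpan C) :
    A ∈ diagGroup C := by
  obtain ⟨g, hg, c, hc, hgc⟩ := exists_mem_pauliGroupOf hC hA
  have hgc' : (g : Matrix (Bits n) (Bits n) ℂ) = c • pauliString 0 (indicatorBits A) := by
    rw [pauliString_zero_left]; exact hgc
  rcases hc with rfl | rfl
  · left
    convert hg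
    ext1
    rw [hgc', one_smul]; rfl
  · right
    convert hg
    ext1
    rw [hgc', neg_one_smul]; rfl

/-- A Pauli string is multiplied by the sign of the symplectic form under conjugation. -/
theorem bitSign_mul_pauliString {n : ℕ} (a b x z s t : Fin n → Fin 2) :
    (bitSign b s : ℂ) * bitSign b t * pauliString x z (s + a) (t + a) =
      bitSign b x * bitSign a z * pauliString x z s t := by
  simp only [pauliString_eq_smul_xzString, Matrix.smul_apply, xzString, Matrix.of_apply,
    smul_eq_mul]
  have hiff : s + a = t + a + x ↔ s = t + x := by
    rw [add_right_comm, add_left_inj]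
  simp only [hiff]
  split_ifs with h
  · have h1 : ((bitSign b t : ℝ) : ℂ) * bitSign b t = 1 := mod_cast bitSign_mul_self b t
    rw [h, bitSign_add_right, bitSign_add_right, bitSign_comm z a]
    push_cast
    linear_combination (bitSign b x * bitSign a z * bitSign z t *
      Complex.I ^ (∑ j, (x j : ℕ) * (z j : ℕ))) * h1
  · simp

/-- Conjugation by a Pauli string that commutes with the support of `C` fixes `C`. -/
theorem pauliConj_eq_self {n : ℕ} {C : Matrix (Bits n) (Bits n) ℝ} {a b : Fin n → Fin 2}
    (h : ∀ x z, pauliCoeff C x z ≠ 0 → bitSign b x * bitSign a z = 1) :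
    pauliConj a b C = C := by
  ext s t
  apply Complex.ofReal_injective
  have hexp : ∀ s t, (C s t : ℂ) = ∑ x, ∑ z, pauliCoeff C x z * pauliString x z s t := by
    intro s t
    have := congrFun (congrFun (pauli_expansion C) s) t
    simpa only [Matrix.map_apply, Matrix.sum_apply, Matrix.smul_apply, smul_eq_mul] using this
  rw [pauliConj, Matrix.of_apply, Complex.ofReal_mul, Complex.ofReal_mul, hexp s t, hexp (s + a),
    Finset.mul_sum]
  refine Finset.sum_congr rfl fun x _ => ?_
  rw [Finset.mul_sum]
  refine Finset.sum_congr rfl fun z _ => ?_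
  by_cases hc : pauliCoeff C x z = 0
  · simp [hc]
  · have h1 : (bitSign b x : ℂ) * bitSign a z = 1 := mod_cast h x z hc
    rw [mul_left_comm, bitSign_mul_pauliString, h1, one_mul]

/-- Linear functionals on `𝔽₂ⁿ × 𝔽₂ⁿ` are the symplectic products with a fixed label `(a, b)`. -/
theorem exists_bitSign_eq_neg_one_pow {n : ℕ}
    (f : (Fin n → ZMod 2) × (Fin n → ZMod 2) →ₗ[ZMod 2] ZMod 2) :
    ∃ a b : Fin n → Fin 2, ∀ x z : Fin n → ZMod 2,
      bitSign b x * bitSign a z = (-1 : ℝ) ^ (f (x, z)).val := by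
  have hadd : ∀ p q : ZMod 2, (-1 : ℝ) ^ (p + q).val = (-1) ^ p.val * (-1) ^ q.val := by
    intro p q
    rw [ZMod.val_add, ← neg_one_pow_eq_pow_mod_two, pow_add]
  have hmul : ∀ p q : ZMod 2, (p * q).val = p.val * q.val := by decide
  have hsum : ∀ (g : Fin n → ZMod 2), (-1 : ℝ) ^ (∑ j, g j).val = ∏ j, (-1 : ℝ) ^ (g j).val := by
    intro g
    induction (Finset.univ : Finset (Fin n)) using Finset.induction_on with
    | empty => simp
    | insert j F hj ih => rw [Finset.sum_insert hj, Finset.prod_insert hj, hadd, ih]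
  have hpi : ∀ (g : (Fin n → ZMod 2) →ₗ[ZMod 2] ZMod 2) (x : Fin n → ZMod 2),
      bitSign (fun j => g (Pi.single j 1)) x = (-1 : ℝ) ^ (g x).val := by
    intro g x
    rw [LinearMap.pi_apply_eq_sum_univ g x, hsum]
    refine Finset.prod_congr rfl fun j _ => ?_
    rw [smul_eq_mul, hmul, mul_comm]
    congr 3
    exact congrArg g (funext fun i => by simp [Pi.single_apply, eq_comm])
  refine ⟨fun j => f (0, Pi.single j 1), fun j => f (Pi.single j 1, 0), fun x z => ?_⟩
  have hsplit : f (x, z) = f (x, 0) + f (0, z) := by rw [← map_add]; simp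
  rw [hsplit, hadd]
  congr 1
  · exact hpi (f.comp (LinearMap.inl _ _ _)) x
  · exact hpi (f.comp (LinearMap.inr _ _ _)) z

/-- If neither `Z_A` nor `-Z_A` is in the generated group, then some Pauli string commutes with `C`
and anticommutes with `Z_A`. -/
theorem exists_pauliConj_of_notMem_diagGroup {n : ℕ} {C : Matrix (Bits n) (Bits n) ℝ}
    (hC : C.IsSymm) {A : Finset (Fin n)} (hA : A ∉ diagGroup C) :
    ∃ a b, pauliConj a b C = C ∧ bitSign (indicatorBits A) a = -1 := by
  obtain ⟨f, hfA, hf⟩ := Submodule.exists_le_ker_of_notMem (p := supportSpan C)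
    (v := ((0, indicatorBits A) : (Fin n → ZMod 2) × (Fin n → ZMod 2)))
    fun h => hA (mem_diagGroup_of_mem_supportSpan hC h)
  obtain ⟨a, b, hab⟩ := exists_bitSign_eq_neg_one_pow f
  refine ⟨a, b, pauliConj_eq_self fun x z hxz => ?_, ?_⟩
  · have : f (x, z) = 0 := hf (Submodule.subset_span (show (x, z) ∈ {v | _} from hxz))
    rw [hab x z, this]
    simp
  · have h1 : f (0, indicatorBits A) = 1 := by
      generalize f (0, indicatorBits A) = r at hfA
      revert r; decide
    have h2 := hab 0 (indicatorBits A)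
    rw [h1] at h2
    have h3 : bitSign b (0 : Fin n → Fin 2) = 1 := by simp [bitSign]
    have h4 : bitSign b (0 : Fin n → Fin 2) * bitSign a (indicatorBits A) = -1 := by
      rw [show (-1 : ℝ) = (-1) ^ (1 : ZMod 2).val by rw [ZMod.val_one, pow_one]]; exact h2
    rwa [h3, one_mul, bitSign_comm] at h4

/-- Symmetrization: the expectations of the `Z_A` with `A` outside the diagonal group can be made to
vanish at no cost. -/
theorem exists_symmetrized {n : ℕ} {C : Matrix (Bits n) (Bits n) ℝ} (hC : C.IsSymm)
    {ρ : Matrix (Bits n) (Bits n) ℝ} (hρ : ρ.PosSemidef) :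
    ∃ σ : Matrix (Bits n) (Bits n) ℝ, σ.PosSemidef ∧ σ.trace = ρ.trace ∧
      (C * σ).trace = (C * ρ).trace ∧
      (∀ A, |(zString A * σ).trace| ≤ |(zString A * ρ).trace|) ∧
      ∀ A ∉ diagGroup C, (zString A * σ).trace = 0 := by
  classical
  obtain ⟨σ, h1, h2, h3, h4, h5⟩ := exists_killing_trace_zString (C := C) hρ
    (Finset.univ.filter (· ∉ diagGroup C))
    fun A hA => exists_pauliConj_of_notMem_diagGroup hC (Finset.mem_filter.mp hA).2
  exact ⟨σ, h1, h2, h3, h4, fun A hA => h5 A (by simpa using hA)⟩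

/-! ### Parseval's identity for the Pauli-`Z` expectations -/

theorem sum_prod_neg_one_pow_mul {n : ℕ} (a b : Bits n) :
    ∑ A : Finset (Fin n), (∏ j ∈ A, (-1 : ℝ) ^ (a j : ℕ)) * ∏ j ∈ A, (-1 : ℝ) ^ (b j : ℕ) =
      if a = b then 2 ^ n else 0 := by
  have key : ∀ p q : Fin 2, (1 : ℝ) + (-1) ^ (p : ℕ) * (-1) ^ (q : ℕ) = if p = q then 2 else 0 := by
    intro p q
    fin_cases p <;> fin_cases q <;> norm_num
  simp only [← Finset.prod_mul_distrib]
  rw [← Finset.powerset_univ, ← Finset.prod_one_add]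
  simp only [key]
  split_ifs with h
  · simp [h]
  · obtain ⟨j, hj⟩ := Function.ne_iff.mp h
    exact Finset.prod_eq_zero (Finset.mem_univ j) (if_neg hj)

theorem trace_zString_mul {n : ℕ} (A : Finset (Fin n)) (ρ : Matrix (Bits n) (Bits n) ℝ) :
    (zString A * ρ).trace = ∑ a, (∏ j ∈ A, (-1 : ℝ) ^ (a j : ℕ)) * ρ a a := by
  simp [zString, Matrix.trace, Matrix.diagonal_mul]

theorem sum_sq_trace_zString_mul {n : ℕ} (ρ : Matrix (Bits n) (Bits n) ℝ) :
    ∑ A, (zString A * ρ).trace ^ 2 = 2 ^ n * ∑ a, ρ a a ^ 2 := by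
  calc ∑ A, (zString A * ρ).trace ^ 2
      = ∑ A : Finset (Fin n), ∑ a, ∑ b, ρ a a * ρ b b *
          ((∏ j ∈ A, (-1 : ℝ) ^ (a j : ℕ)) * ∏ j ∈ A, (-1 : ℝ) ^ (b j : ℕ)) := by
        refine Finset.sum_congr rfl fun A _ => ?_
        rw [trace_zString_mul, sq, Finset.sum_mul_sum]
        refine Finset.sum_congr rfl fun a _ => Finset.sum_congr rfl fun b _ => ?_
        ring
    _ = ∑ a, ∑ b, ρ a a * ρ b b * if a = b then 2 ^ n else 0 := by
        rw [Finset.sum_comm]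
        refine Finset.sum_congr rfl fun a _ => ?_
        rw [Finset.sum_comm]
        refine Finset.sum_congr rfl fun b _ => ?_
        rw [← Finset.mul_sum, sum_prod_neg_one_pow_mul]
    _ = 2 ^ n * ∑ a, ρ a a ^ 2 := by
        rw [Finset.mul_sum]
        refine Finset.sum_congr rfl fun a _ => ?_
        simp only [mul_ite, mul_zero, Finset.sum_ite_eq, Finset.mem_univ, if_true]
        ring

theorem trace_zString_empty_mul {n : ℕ} (ρ : Matrix (Bits n) (Bits n) ℝ) :
    (zString ∅ * ρ).trace = ρ.trace := by
  rw [trace_zString_mul]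
  simp [Matrix.trace]

/-- The `ℓ²`-distance of the diagonal from the uniform distribution is carried by the nontrivial
Pauli-`Z` expectations. -/
theorem sum_sq_diag_sub {n : ℕ} {ρ : Matrix (Bits n) (Bits n) ℝ} (hρ : ρ.trace = 1) :
    2 ^ n * ∑ a, (ρ a a - 1 / 2 ^ n) ^ 2 =
      ∑ A ∈ Finset.univ.erase ∅, (zString A * ρ).trace ^ 2 := by
  have h1 := Finset.add_sum_erase Finset.univ (fun A => (zString A * ρ).trace ^ 2)
    (Finset.mem_univ ∅)
  simp only [trace_zString_empty_mul, hρ, sum_sq_trace_zString_mul] at h1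
  have h2 : ∑ a, ρ a a = 1 := hρ
  have h3 : ∑ a, (ρ a a - 1 / 2 ^ n) ^ 2 = ∑ a, ρ a a ^ 2 - 1 / 2 ^ n := by
    simp only [sub_sq, Finset.sum_add_distrib, Finset.sum_sub_distrib, ← Finset.sum_mul,
      ← Finset.mul_sum, h2, Finset.sum_const, Finset.card_univ, nsmul_eq_mul]
    simp
    field_simp
    ring
  rw [h3, mul_sub, ← h1]
  field_simp
  ring

/-! ### Objectives of operator norm at most one -/

theorem opNorm_inv_smul_le {n : ℕ} (C : Matrix (Bits n) (Bits n) ℝ) :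
    opNorm ((opNorm C)⁻¹ • C) ≤ 1 := by
  have h : opNorm ((opNorm C)⁻¹ • C) = (opNorm C)⁻¹ * opNorm C := by
    rw [opNorm, map_smul, norm_smul, ← opNorm, Real.norm_of_nonneg]
    exact inv_nonneg.mpr (norm_nonneg _)
  rw [h]
  exact inv_mul_le_one

theorem exists_transpose_mul_self {ι : Type*} [Fintype ι] {ρ : Matrix ι ι ℝ}
    (hρ : ρ.PosSemidef) : ∃ (m : ℕ) (B : Matrix (Fin m) ι ℝ), ρ = B.transpose * B := by
  obtain ⟨m, v, hv⟩ := Matrix.posSemidef_iff_eq_sum_vecMulVec.mp hρ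
  refine ⟨m, Matrix.of v, ?_⟩
  ext s t
  simp [hv, Matrix.sum_apply, Matrix.mul_apply, Matrix.vecMulVec_apply]

/-- The Cauchy-Schwarz inequality for the bilinear form `tr (M Bᵀ B')`. -/
theorem abs_trace_mul_transpose_mul_le {n m : ℕ} {M : Matrix (Bits n) (Bits n) ℝ}
    (hM : opNorm M ≤ 1) (B B' : Matrix (Fin m) (Bits n) ℝ) :
    |(M * (B.transpose * B')).trace| ≤
      √(B.transpose * B).trace * √(B'.transpose * B').trace := by
  have hnorm : ∀ B : Matrix (Fin m) (Bits n) ℝ,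
      (B.transpose * B).trace = ∑ i, ‖WithLp.toLp 2 (B i)‖ ^ 2 := by
    intro B
    rw [Matrix.trace_mul_comm]
    simp only [EuclideanSpace.norm_sq_eq]
    simp [Matrix.trace, Matrix.mul_apply, sq]
  have htr : (M * (B.transpose * B')).trace =
      ∑ i, inner ℝ (WithLp.toLp 2 (B' i))
        (Matrix.toEuclideanCLM (n := Bits n) (𝕜 := ℝ) M (WithLp.toLp 2 (B i))) := by
    simp only [Matrix.inner_toEuclideanCLM]
    rw [← Matrix.mul_assoc, Matrix.trace_mul_comm]
    simp [Matrix.trace, Matrix.mul_apply, dotProduct, Matrix.mulVec]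
  rw [htr, hnorm, hnorm]
  calc _ ≤ ∑ i, ‖WithLp.toLp 2 (B i)‖ * ‖WithLp.toLp 2 (B' i)‖ := by
        refine (Finset.abs_sum_le_sum_abs _ _).trans (Finset.sum_le_sum fun i _ => ?_)
        refine (abs_real_inner_le_norm _ _).trans ?_
        rw [mul_comm]
        refine mul_le_mul_of_nonneg_right ?_ (norm_nonneg _)
        refine (ContinuousLinearMap.le_opNorm _ _).trans ?_
        exact mul_le_of_le_one_left (norm_nonneg _) hM
    _ ≤ _ := Real.sum_mul_le_sqrt_mul_sqrt _ _ _

theorem abs_trace_mul_le_trace {n : ℕ} {M ρ : Matrix (Bits n) (Bits n) ℝ}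
    (hM : opNorm M ≤ 1) (hρ : ρ.PosSemidef) : |(M * ρ).trace| ≤ ρ.trace := by
  have h0 := hρ.trace_nonneg
  obtain ⟨m, B, rfl⟩ := exists_transpose_mul_self hρ
  have h := abs_trace_mul_transpose_mul_le hM B B
  rwa [Real.mul_self_sqrt h0] at h

/-! ### Rounding to a uniform diagonal -/

/-- Cutting a diagonal entry `d` down to at most the target `u`: the factor `s` rescales the Gram
vector of squared length `d`. -/
theorem exists_cutoff {u d : ℝ} (hu : 0 < u) (hd : 0 ≤ d) :
    ∃ s : ℝ, 0 ≤ s ∧ s ≤ 1 ∧ s ^ 2 * d ≤ u ∧ u - s ^ 2 * d ≤ |d - u| ∧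
      (1 - s) ^ 2 * d ≤ u⁻¹ * (d - u) ^ 2 := by
  rcases le_or_gt d u with h | h
  · refine ⟨1, by norm_num, le_rfl, by simpa using h, ?_, ?_⟩
    · rw [abs_sub_comm]; simpa using le_abs_self (u - d)
    · simp; positivity
  · have hd' : 0 < d := hu.trans h
    have hs : √(u / d) ^ 2 * d = u := by
      rw [Real.sq_sqrt (by positivity)]; field_simp
    have hs1 : √(u / d) ≤ 1 := by
      exact Real.sqrt_le_one.mpr ((div_le_one hd').mpr h.le)
    have hs0 := Real.sqrt_nonneg (u / d)
    refine ⟨√(u / d), hs0, hs1, hs.le, by simp [hs], ?_⟩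
    -- `(1 - s)² ≤ (1 - s²)²` and `u (1 - s²)² d ≤ (d (1 - s²))² = (d - u)²`
    generalize √(u / d) = s at hs hs0 hs1
    have h1 : d - u = d * (1 - s ^ 2) := by rw [← hs]; ring
    have h2 : (1 - s) ^ 2 ≤ (1 - s ^ 2) ^ 2 := by
      apply pow_le_pow_left₀ <;> nlinarith
    rw [h1, mul_pow, ← div_eq_inv_mul, le_div_iff₀ hu]
    have h3 : d * u ≤ d ^ 2 := by nlinarith
    calc (1 - s) ^ 2 * d * u = (1 - s) ^ 2 * (d * u) := by ring
      _ ≤ (1 - s ^ 2) ^ 2 * d ^ 2 := by gcongr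
      _ = _ := by ring

/-- A density matrix whose diagonal is `δ`-close to uniform is close, against every objective of
operator norm at most one, to a density matrix with uniform diagonal. -/
theorem exists_mem_gwExactFeasible_close {n : ℕ} {ρ : Matrix (Bits n) (Bits n) ℝ}
    (hρ : ρ.PosSemidef) (htr : ρ.trace = 1) {δ : ℝ} (hδ : 0 ≤ δ)
    (hdiag : 2 ^ n * ∑ a, (ρ a a - 1 / 2 ^ n) ^ 2 ≤ δ ^ 2) :
    ∃ σ ∈ gwExactFeasible n, ∀ M : Matrix (Bits n) (Bits n) ℝ, opNorm M ≤ 1 →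
      (M * ρ).trace ≤ (M * σ).trace + 3 * δ := by
  have hu : (0 : ℝ) < 1 / 2 ^ n := by positivity
  have hd : ∀ a, 0 ≤ ρ a a := fun a => hρ.diag_nonneg
  choose s hs0 hs1 hsle hsabs hssq using fun a => exists_cutoff hu (hd a)
  set l : Bits n → ℝ := fun a => 1 / 2 ^ n - s a ^ 2 * ρ a a with hl
  have hl0 : ∀ a, 0 ≤ l a := fun a => sub_nonneg.mpr (hsle a)
  obtain ⟨m, B, hB⟩ := exists_transpose_mul_self hρ
  set D : Matrix (Bits n) (Bits n) ℝ := Matrix.diagonal s with hD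
  have hL : (Matrix.diagonal l).PosSemidef := Matrix.PosSemidef.diagonal hl0
  have hDD : ((B * D).transpose * (B * D)).PosSemidef :=
    Matrix.posSemidef_conjTranspose_mul_self (B * D)
  have hentry : ∀ e : Bits n → ℝ, ∀ a, ((B * Matrix.diagonal e).transpose *
      (B * Matrix.diagonal e)) a a = e a ^ 2 * ρ a a := by
    intro e a
    rw [hB, Matrix.mul_apply, Matrix.mul_apply, Finset.mul_sum]
    refine Finset.sum_congr rfl fun i _ => ?_
    simp only [Matrix.transpose_apply, Matrix.mul_diagonal]
    ring
  have hltr : (Matrix.diagonal l).trace ≤ δ := by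
    rw [Matrix.trace_diagonal]
    have h1 : (∑ a, |ρ a a - 1 / 2 ^ n|) ^ 2 ≤ δ ^ 2 := by
      refine (sq_sum_le_card_mul_sum_sq (s := Finset.univ)).trans ?_
      simpa [sq_abs] using hdiag
    exact (Finset.sum_le_sum fun a _ => hsabs a).trans (abs_le_of_sq_le_sq' h1 hδ).2
  have hEtr : √((B - B * D).transpose * (B - B * D)).trace ≤ δ := by
    have h1 : B - B * D = B * Matrix.diagonal fun a => 1 - s a := by
      ext i a
      simp [hD, Matrix.mul_diagonal]
      ring
    refine Real.sqrt_le_iff.mpr ⟨hδ, ?_⟩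
    rw [h1, Matrix.trace]
    simp only [Matrix.diag, hentry]
    refine (Finset.sum_le_sum fun a _ => hssq a).trans ?_
    rw [← Finset.mul_sum]
    simpa using hdiag
  have hBtr : √(B.transpose * B).trace ≤ 1 := by rw [← hB, htr, Real.sqrt_one]
  have hDtr : √((B * D).transpose * (B * D)).trace ≤ 1 := by
    rw [Real.sqrt_le_one, ← htr, Matrix.trace, Matrix.trace]
    refine Finset.sum_le_sum fun a _ => ?_
    rw [Matrix.diag_apply, Matrix.diag_apply, hentry]
    exact mul_le_of_le_one_left (hd a) (pow_le_one₀ (hs0 a) (hs1 a))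
  refine ⟨(B * D).transpose * (B * D) + Matrix.diagonal l, ⟨hDD.add hL, fun a => ?_⟩,
    fun M hM => ?_⟩
  · rw [Matrix.add_apply, hentry, Matrix.diagonal_apply_eq]
    simp [hl]
  · have h1 := (abs_le.mp (abs_trace_mul_le_trace hM hL)).1
    have h2 := (le_abs_self _).trans (abs_trace_mul_transpose_mul_le hM (B - B * D) B)
    have h3 := (le_abs_self _).trans (abs_trace_mul_transpose_mul_le hM (B * D) (B - B * D))
    have h4 := h2.trans (mul_le_mul hEtr hBtr (Real.sqrt_nonneg _) hδ)
    have h5 := h3.trans (mul_le_mul hDtr hEtr (Real.sqrt_nonneg _) zero_le_one)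
    -- `BᵀB - (BD)ᵀ(BD) = (B - BD)ᵀ B + (BD)ᵀ (B - BD)`
    have h6 : (M * ρ).trace = (M * ((B - B * D).transpose * B)).trace +
        (M * ((B * D).transpose * (B - B * D))).trace +
        (M * ((B * D).transpose * (B * D))).trace := by
      rw [← Matrix.trace_add, ← Matrix.trace_add, ← Matrix.mul_add, ← Matrix.mul_add, hB,
        Matrix.transpose_sub]
      congr 2
      simp only [Matrix.mul_sub, Matrix.sub_mul]
      abel
    rw [Matrix.mul_add, Matrix.trace_add]
    linarith

/-! ### Comparison of the values -/

theorem trace_eq_one_of_mem_gwExactFeasible {n : ℕ} {ρ : Matrix (Bits n) (Bits n) ℝ}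
    (hρ : ρ ∈ gwExactFeasible n) : ρ.trace = 1 := by
  simp [Matrix.trace, hρ.2]

theorem gwExactFeasible_subset {n : ℕ} {S : Set (Finset (Fin n))} (hS : ∅ ∉ S) {ε : ℝ}
    (hε : 0 ≤ ε) : gwExactFeasible n ⊆ gwFeasible S ε := by
  intro ρ hρ
  refine ⟨hρ.1, trace_eq_one_of_mem_gwExactFeasible hρ, fun A hA => ?_⟩
  -- a uniform diagonal has the same Pauli-`Z` expectations as the maximally mixed state
  have h := (maximallyMixed_mem hS hε).2.2 A hA
  have : (zString A * ρ).trace =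
      (zString A * ((1 / 2 ^ n : ℝ) • (1 : Matrix (Bits n) (Bits n) ℝ))).trace := by
    simp only [trace_zString_mul, hρ.2, Matrix.smul_apply, Matrix.one_apply_eq, smul_eq_mul,
      mul_one]
  rwa [this]

theorem bddAbove_relaxed {n : ℕ} (M : Matrix (Bits n) (Bits n) ℝ) (S : Set (Finset (Fin n)))
    (ε : ℝ) : BddAbove ((fun ρ => (M * ρ).trace) '' gwFeasible S ε) :=
  bddAbove_objective M _ fun _ h => ⟨h.1, h.2.1⟩

theorem bddAbove_exact {n : ℕ} (M : Matrix (Bits n) (Bits n) ℝ) :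
    BddAbove ((fun ρ => (M * ρ).trace) '' gwExactFeasible n) :=
  bddAbove_objective M _ fun _ h => ⟨h.1, trace_eq_one_of_mem_gwExactFeasible h⟩

theorem empty_notMem_diagGroupDot {n : ℕ} (C : Matrix (Bits n) (Bits n) ℝ) :
    ∅ ∉ diagGroupDot C := fun h => h.2 rfl

theorem empty_mem_diagGroup {n : ℕ} (C : Matrix (Bits n) (Bits n) ℝ) : ∅ ∈ diagGroup C := by
  left
  convert one_mem (pauliGroupOf C)
  ext1
  change pauliString 0 (indicatorBits ∅) = 1
  have : indicatorBits (∅ : Finset (Fin n)) = 0 := by ext j; simp [indicatorBits]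
  rw [this, pauliString_zero_left, xzString_zero_zero]

theorem trace_normalized_mul {n : ℕ} (C ρ : Matrix (Bits n) (Bits n) ℝ) :
    ((opNorm C)⁻¹ • C * ρ).trace = (opNorm C)⁻¹ * (C * ρ).trace := by
  rw [Matrix.smul_mul, Matrix.trace_smul, smul_eq_mul]

/-- The constraints outside the diagonal group are redundant. -/
theorem GWrel_diagGroupDot_eq {n : ℕ} {C : Matrix (Bits n) (Bits n) ℝ} (hC : C.IsSymm) {ε : ℝ}
    (hε : 0 ≤ ε) : GWrel C (diagGroupDot C) ε = GWrel C {A | A ≠ ∅} ε := by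
  apply le_antisymm
  · refine csSup_le (Set.Nonempty.image _
      ⟨_, maximallyMixed_mem (empty_notMem_diagGroupDot C) hε⟩) ?_
    rintro _ ⟨ρ, ⟨hpsd, htr, hz⟩, rfl⟩
    obtain ⟨σ, h1, h2, h3, h4, h5⟩ := exists_symmetrized hC hpsd
    refine le_csSup (bddAbove_relaxed _ _ ε) ⟨σ, ⟨h1, h2.trans htr, fun A hA => ?_⟩, ?_⟩
    · by_cases hAD : A ∈ diagGroup C
      · exact (h4 A).trans (hz A ⟨hAD, hA⟩)
      · rw [h5 A hAD, abs_zero]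
        exact hε
    · simp only [trace_normalized_mul, h3]
  · refine csSup_le_csSup (bddAbove_relaxed _ _ ε) (Set.Nonempty.image _
      ⟨_, maximallyMixed_mem (by simp) hε⟩) (Set.image_mono ?_)
    exact fun ρ h => ⟨h.1, h.2.1, fun A hA => h.2.2 A hA.2⟩

/-- Symmetrization leaves `2 ^ k - 1` Pauli-`Z` expectations of size at most `ε`, so that the diagonal
is `√(2 ^ k - 1) ε`-close to uniform and rounding applies. -/
theorem GWrel_sub_GW_le {n : ℕ} {C : Matrix (Bits n) (Bits n) ℝ} (hC : C.IsSymm) {k : ℕ}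
    (hk : (diagGroup C).ncard = 2 ^ k) {ε : ℝ} (hε : 0 ≤ ε) :
    GWrel C (diagGroupDot C) ε ≤ GW C + 3 * (√(2 ^ k - 1) * ε) := by
  classical
  have hk1 : (0 : ℝ) ≤ 2 ^ k - 1 := sub_nonneg.mpr (one_le_pow₀ one_le_two)
  refine csSup_le (Set.Nonempty.image _
    ⟨_, maximallyMixed_mem (empty_notMem_diagGroupDot C) hε⟩) ?_
  rintro _ ⟨ρ, ⟨hpsd, htr, hz⟩, rfl⟩
  obtain ⟨σ, h1, h2, h3, h4, h5⟩ := exists_symmetrized hC hpsd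
  have hdiag : 2 ^ n * ∑ a, (σ a a - 1 / 2 ^ n) ^ 2 ≤ (√(2 ^ k - 1) * ε) ^ 2 := by
    have hcard : (((Finset.univ.erase ∅).filter (· ∈ diagGroup C)).card : ℝ) = 2 ^ k - 1 := by
      have hset : (((Finset.univ.erase ∅).filter (· ∈ diagGroup C) : Finset (Finset (Fin n))) :
          Set (Finset (Fin n))) = diagGroup C \ {∅} := by
        ext A
        simp [and_comm]
      rw [← Set.ncard_coe_finset, hset, Set.ncard_sdiff_singleton_of_mem (empty_mem_diagGroup C), hk,
        Nat.cast_sub Nat.one_le_two_pow]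
      simp
    rw [sum_sq_diag_sub (h2.trans htr), mul_pow, Real.sq_sqrt hk1, ← hcard, ← nsmul_eq_mul,
      ← Finset.sum_filter_add_sum_filter_not _ (· ∈ diagGroup C),
      Finset.sum_eq_zero (s := Finset.filter (fun A => A ∉ diagGroup C) _)
        fun A hA => by rw [h5 A (Finset.mem_filter.mp hA).2, sq, zero_mul], add_zero]
    refine Finset.sum_le_card_nsmul _ _ _ fun A hA => ?_
    rw [Finset.mem_filter, Finset.mem_erase] at hA
    rw [← sq_abs]
    exact pow_le_pow_left₀ (abs_nonneg _) ((h4 A).trans (hz A ⟨hA.2, hA.1.1⟩)) 2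
  obtain ⟨τ, hτ, hclose⟩ := exists_mem_gwExactFeasible_close h1 (h2.trans htr) (by positivity) hdiag
  have h6 := hclose _ (opNorm_inv_smul_le C)
  rw [trace_normalized_mul, h3, ← trace_normalized_mul] at h6
  have h7 : ((opNorm C)⁻¹ • C * τ).trace ≤ GW C := le_csSup (bddAbove_exact _) ⟨τ, hτ, rfl⟩
  exact h6.trans (by linarith)

theorem GW_le_GWrel {n : ℕ} (C : Matrix (Bits n) (Bits n) ℝ) {ε : ℝ} (hε : 0 ≤ ε) :
    GW C ≤ GWrel C (diagGroupDot C) ε :=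
  csSup_le_csSup (bddAbove_relaxed _ _ ε) (Set.Nonempty.image _ ⟨_, maximallyMixed_mem_exact n⟩)
    (Set.image_mono (gwExactFeasible_subset (empty_notMem_diagGroupDot C) hε))

theorem GWrel_le_one {n : ℕ} (C : Matrix (Bits n) (Bits n) ℝ) {ε : ℝ} (hε : 0 ≤ ε) :
    GWrel C (diagGroupDot C) ε ≤ 1 := by
  refine csSup_le (Set.Nonempty.image _
    ⟨_, maximallyMixed_mem (empty_notMem_diagGroupDot C) hε⟩) ?_
  rintro _ ⟨ρ, hρ, rfl⟩
  exact (le_abs_self _).trans ((abs_trace_mul_le_trace (opNorm_inv_smul_le C) hρ.1).trans hρ.2.1.le)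

theorem neg_one_le_GW {n : ℕ} (C : Matrix (Bits n) (Bits n) ℝ) : -1 ≤ GW C := by
  have h := maximallyMixed_mem_exact n
  refine le_trans ?_ (le_csSup (bddAbove_exact _) ⟨_, h, rfl⟩)
  have h2 := (abs_le.mp (abs_trace_mul_le_trace (opNorm_inv_smul_le C) h.1)).1
  rwa [trace_eq_one_of_mem_gwExactFeasible h] at h2

end

theorem theorem1 :
    (∀ (n : ℕ) (C : Matrix (Bits n) (Bits n) ℝ), C.IsSymm → ∀ ε : ℝ, 0 ≤ ε →
      GWrel C (diagGroupDot C) ε = GWrel C {A | A ≠ ∅} ε) ∧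
    (∃ K : ℝ, 0 < K ∧ ∀ (n : ℕ) (C : Matrix (Bits n) (Bits n) ℝ), C.IsSymm →
      ∀ k : ℕ, (diagGroup C).ncard = 2 ^ k → ∀ ε : ℝ, 0 ≤ ε →
        |GWrel C (diagGroupDot C) ε - GW C| ≤
          K * (((2 : ℝ) ^ k - 1) ^ (1 / 6 : ℝ) * ε ^ (1 / 3 : ℝ))) := by
  refine ⟨fun n C hC ε hε => GWrel_diagGroupDot_eq hC hε, 3, by norm_num,
    fun n C hC k hk ε hε => ?_⟩
  have hk1 : (0 : ℝ) ≤ 2 ^ k - 1 := sub_nonneg.mpr (one_le_pow₀ one_le_two)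
  set δ : ℝ := √(2 ^ k - 1) * ε with hδ
  have hδ0 : 0 ≤ δ := by positivity
  have hpow : ((2 : ℝ) ^ k - 1) ^ (1 / 6 : ℝ) * ε ^ (1 / 3 : ℝ) = δ ^ (1 / 3 : ℝ) := by
    rw [hδ, Real.mul_rpow (Real.sqrt_nonneg _) hε, Real.sqrt_eq_rpow, ← Real.rpow_mul hk1]
    norm_num
  rw [hpow, abs_of_nonneg (sub_nonneg.mpr (GW_le_GWrel C hε))]
  -- for `δ ≤ 1` the linear bound is stronger; for `δ > 1` both values lie in `[-1, 1]`
  rcases le_or_gt δ 1 with h | h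
  · have h1 := GWrel_sub_GW_le hC hk hε
    have h2 : δ ≤ δ ^ (1 / 3 : ℝ) := by
      simpa using Real.rpow_le_rpow_of_exponent_ge_of_imp hδ0 h (by norm_num : (1 / 3 : ℝ) ≤ 1)
        (by norm_num)
    linarith
  · have h1 := GWrel_le_one C hε
    have h2 := neg_one_le_GW C
    have h3 : 1 ≤ δ ^ (1 / 3 : ℝ) := Real.one_le_rpow h.le (by norm_num)
    linarith
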